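/- Let $X$ be a real Banach space with dual $X^*$. For $f\colon X\to\mathbb R$, let $f'(x,v)=\lim_{\alpha\to+0}(f(x+\alpha v)-f(x))/\alpha$. A pair $[\underline\partial f(x),\overline\partial f(x)]$ of convex weak$^*$ compact subsets of $X^*$ is a quasidifferential of $f$ at $x$ if $f'(x,v)$ exists, is finite and equals $\max_{a\in\underline\partial f(x)}\langle a,v\rangle+\min_{b\in\overline\partial f(x)}\langle b,v\rangle$ for all $v\in X$. We say that $f$ is directionally differentiable at $x$ uniformly along finite dimensional spaces if, for all $v\in X$ and all finite dimensional subspaces $X_0\subset X$, $f'(x,v)$ exists and is the limit of $(f(x+\alpha v')-f(x))/\alpha$ as $\alpha\to+0$, $v'\to v$, $v'\in v+X_0$; $f$ is Hadamard directionally differentiable at $x$ if for every $v\in X$ this quotient has a finite limit as $\alpha\to+0$, $v'\to v$, $v'\in X$. For $C\subset X^*$ let $s(C,v)=\sup_{c\in C}\langle c,v\rangle$, and let $\operatorname{cone}$ denote the smallest convex cone (containing $0$) that contains a given family of sets. Let $I=\{1,\dots,m\}$, $J=\{1,\dots,l\}$ (either may be empty), let $f_0,f_i,g_j\colon X\to\mathbb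 R$, and let $\overline x$ be a locally optimal solution of $$\min f_0(x)\quad\text{s.t.}\quad f_i(x)=0\ (i\in I),\qquad g_j(x)\le 0\ (j\in J).$$ Put $J(\overline x)=\{j\in J: g_j(\overline x)=0\}$. Let quasidifferentials at $\overline x$ of all the functions $f_0$, $f_i$, $g_j$ be given, and below write $\underline\partial f$, $\overline\partial f$ for $\underline\partial f(\overline x)$, $\overline\partial f(\overline x)$. Assume: 1. $f_0$ is Hadamard directionally differentiable at $\overline x$; 2. each $f_i$, $i\in I$, is continuous in a neighbourhood of $\overline x$ and directionally differentiable at $\overline x$ uniformly along finite dimensional spaces; 3. $g_j$ is upper semicontinuous at $\overline x$ for $j\notin J(\overline x)$, and directionally differentiable at $\overline x$ uniformly along finite dimensional spaces for $j\in J(\overline x)$; 4. $x_i^*\in\underline\partial f_i$, $y_i^*\in\overline\partial f_i$ ($i\in I$) and $z_j^*\in\overline\partial g_j$ ($j\in J(\overline x)$) are such that: - for every $i\in I$ there is $v_i\in X$ with $s(\underline\partial f_i+y_i^*,v_i)<0$ and, for all $k\ne i$, $s(\underline\partial f_k+y_k^*,v_i)\le0$ and $s(-x_k^*-\overline\partial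 f_k,v_i)\le0$; - for every $i\in I$ there is $w_i\in X$ with $s(-x_i^*-\overline\partial f_i,w_i)<0$ and, for all $k\ne i$, $s(-x_k^*-\overline\partial f_k,w_i)\le0$ and $s(\underline\partial f_k+y_k^*,w_i)\le0$; - there is $v_0\in X$ with $s(\underline\partial g_j+z_j^*,v_0)<0$ for all $j\in J(\overline x)$ and, for all $i\in I$, $s(\underline\partial f_i+y_i^*,v_0)\le0$ and $s(-x_i^*-\overline\partial f_i,v_0)\le0$. Let $C_i=(\underline\partial f_i+y_i^*)\cup(-x_i^*-\overline\partial f_i)$. If $\operatorname{cone}\{C_i: i\in I\}$ is weak$^*$ closed, then for any $y_0^*\in\overline\partial f_0$ and any $z_j^*\in\overline\partial g_j$, $j\notin J(\overline x)$, there exist $\underline\mu_i\ge0$, $\overline\mu_i\ge0$ ($i\in I$) and $\lambda_j\ge0$ ($j\in J$) such that $\lambda_jg_j(\overline x)=0$ for all $j\in J$ and $$0\in\underline\partial f_0+y_0^*+\sum_{i=1}^m\underline\mu_i(\underline\partial f_i+y_i^*)-\sum_{i=1}^m\overline\mu_i(x_i^*+\overline\partial f_i)+\sum_{j=1}^l\lambda_j(\underline\partial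 g_j+z_j^*).$$ Moreover, $\operatorname{cone}\{C_i: i\in I\}$ is weak$^*$ closed whenever all the sets $\underline\partial f_i$, $\overline\partial f_i$, $i\in I$, are polytopes (convex hulls of finitely many points). -/

import Mathlib

open Set Filter Topology
open scoped Pointwise

namespace Quasidiff

noncomputable section

/-- `d` is the directional derivative `f'(x, v)`. -/
def HasDirDerivAt {X : Type*} [NormedAddCommGroup X] [NormedSpace ℝ X]
    (f : X → ℝ) (x v : X) (d : ℝ) : Prop :=
  Tendsto (fun α : ℝ => (f (x + α • v) - f x) / α) (𝓝[>] (0 : ℝ)) (𝓝 d)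

/-- `f` is directionally differentiable at `x` uniformly along finite dimensional spaces:
`f'(x, v)` exists, and for every finite dimensional `X₀` it is the limit of the difference quotients
`(f (x + α v') - f x) / α` as `α → +0`, `v' → v`, `v' ∈ v + X₀`. -/
def DirDiffUnifFinDimAt {X : Type*} [NormedAddCommGroup X] [NormedSpace ℝ X]
    (f : X → ℝ) (x : X) : Prop :=
  ∀ v : X, ∃ d : ℝ, HasDirDerivAt f x v d ∧
    ∀ X₀ : Submodule ℝ X, FiniteDimensional ℝ X₀ →
      Tendsto (fun p : ℝ × X => (f (x + p.1 • p.2) - f x) / p.1)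
        (𝓝[>] (0 : ℝ) ×ˢ 𝓝[{v' : X | v' - v ∈ X₀}] v) (𝓝 d)

/-- `f` is Hadamard directionally differentiable at `x`. -/
def HadamardDirDiffAt {X : Type*} [NormedAddCommGroup X] [NormedSpace ℝ X]
    (f : X → ℝ) (x : X) : Prop :=
  ∀ v : X, ∃ d : ℝ,
    Tendsto (fun p : ℝ × X => (f (x + p.1 • p.2) - f x) / p.1)
      (𝓝[>] (0 : ℝ) ×ˢ 𝓝 v) (𝓝 d)

/-- The pair `[A, B]` of convex weak* compact sets is a quasidifferential of `f` at `x`: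
`f` is directionally differentiable at `x` and
`f'(x, v) = max_{a ∈ A} ⟨a, v⟩ + min_{b ∈ B} ⟨b, v⟩` for all `v`.
`A` is the subdifferential, `B` the superdifferential. `WeakDual ℝ X` is the dual `X*` with the
weak* topology. -/
structure IsQuasidifferentialAt {X : Type*} [NormedAddCommGroup X] [NormedSpace ℝ X]
    (f : X → ℝ) (x : X) (A B : Set (WeakDual ℝ X)) : Prop where
  convex_sub : Convex ℝ A
  compact_sub : IsCompact A
  convex_sup : Convex ℝ B
  compact_sup : IsCompact B
  dirDeriv : ∀ v : X, ∃ a b : ℝ,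
    IsGreatest ((fun φ : WeakDual ℝ X => φ v) '' A) a ∧
    IsLeast ((fun φ : WeakDual ℝ X => φ v) '' B) b ∧
    HasDirDerivAt f x v (a + b)

/-- The support function `s(C, v) = sup_{φ ∈ C} ⟨φ, v⟩`; it is used only for non-empty
weak* compact sets `C`, where the supremum is finite. -/
def supportFn {X : Type*} [NormedAddCommGroup X] [NormedSpace ℝ X]
    (C : Set (WeakDual ℝ X)) (v : X) : ℝ :=
  sSup ((fun φ : WeakDual ℝ X => φ v) '' C)

/-- The feasible set `{x | f_i x = 0 for all i, g_j x ≤ 0 for all j}`. -/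
def feasibleSet {X : Type*} {m l : ℕ} (f : Fin m → X → ℝ) (g : Fin l → X → ℝ) : Set X :=
  {x | (∀ i, f i x = 0) ∧ ∀ j, g j x ≤ 0}

/-- The constraint qualification, for the subdifferentials `A i`, superdifferentials `B i` of the
equality constraints, the subdifferentials `P j` of the inequality constraints, the selected vectors
`x i`, `y i`, `z j`, and the set `Jact` of indices of active inequality constraints. -/
structure ConstraintQualification {X : Type*} [NormedAddCommGroup X] [NormedSpace ℝ X] {m l : ℕ}
    (A B : Fin m → Set (WeakDual ℝ X)) (x y : Fin m → WeakDual ℝ X)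
    (P : Fin l → Set (WeakDual ℝ X)) (z : Fin l → WeakDual ℝ X) (Jact : Set (Fin l)) : Prop where
  lower : ∀ i, ∃ v : X, supportFn (A i + {y i}) v < 0 ∧
    ∀ k, k ≠ i → supportFn (A k + {y k}) v ≤ 0 ∧ supportFn ({-x k} - B k) v ≤ 0
  upper : ∀ i, ∃ w : X, supportFn ({-x i} - B i) w < 0 ∧
    ∀ k, k ≠ i → supportFn ({-x k} - B k) w ≤ 0 ∧ supportFn (A k + {y k}) w ≤ 0
  slater : ∃ v : X, (∀ j ∈ Jact, supportFn (P j + {z j}) v < 0) ∧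
    ∀ i, supportFn (A i + {y i}) v ≤ 0 ∧ supportFn ({-x i} - B i) v ≤ 0

/-- `cone {C_i : i ∈ I}`, the smallest convex cone with vertex `0` containing all the sets
`C_i = (A i + y i) ∪ (-x i - B i)`. -/
def constraintCone {X : Type*} [NormedAddCommGroup X] [NormedSpace ℝ X] {m : ℕ}
    (A B : Fin m → Set (WeakDual ℝ X)) (x y : Fin m → WeakDual ℝ X) : Set (WeakDual ℝ X) :=
  (PointedCone.hull ℝ (⋃ i, ((A i + {y i}) ∪ ({-x i} - B i))) : PointedCone ℝ (WeakDual ℝ X))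

/-- A polytope is the convex hull of a finite set of points. -/
def IsPolytope {E : Type*} [AddCommGroup E] [Module ℝ E] (S : Set E) : Prop :=
  ∃ F : Set E, F.Finite ∧ S = convexHull ℝ F

end

end Quasidiff

/-! The multiplier rule is a separation statement. Let `K` be the compact convex set of convex
combinations of points of `A₀ + {y₀}` and of the active sets `P j + {z j}`, and let `N` be the
closed constraint cone. If `K` meets `-N`, a common point provides the multipliers: the Slater
vector forces the weight of `A₀ + {y₀}` to be positive, so it can be scaled to 1. Otherwise
Hahn–Banach yields a direction `u` that is negative on `K` and nonpositive on `N`, which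
`exists_nonneg_of_isLocalMinOn` excludes at a local minimum.

For that exclusion, the equality constraints have zero derivative along `u`, so `u` has to be
corrected to reach the feasible set. It is replaced by `u + ε • cornerMap v w τ` with `τ` in the
cube `[-1, 1]^m`; the vectors of the constraint qualification make `f i` decrease on the face `τ i =
1` and increase on the face `τ i = -1`. Compactness gives one step size for all `τ`, and
Poincaré–Miranda then gives a `τ` at which every `f i` vanishes. The resulting point is feasible
with a smaller objective.

Poincaré–Miranda itself follows from a volume argument in the style of Milnor and Rogers. In the
polytope case the cone is finitely generated, hence by Carathéodory a finite union of closed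
simplicial cones. -/

/-! ### The Poincaré–Miranda theorem. -/

section PoincareMiranda

open MeasureTheory

variable {ι : Type*}

/-- The cube `[-1, 1]^ι`. -/
def unitCube (ι : Type*) : Set (ι → ℝ) := Icc (-1) 1

/-- The nearest-point projection onto the cube `[-1, 1]^ι`. -/
def cubeProj (x : ι → ℝ) : ι → ℝ := fun i => max (-1) (min 1 (x i))

theorem cubeProj_mem (x : ι → ℝ) : cubeProj x ∈ unitCube ι :=
  ⟨fun _ => le_max_left _ _, fun _ => max_le (by norm_num) (min_le_left _ _)⟩

theorem cubeProj_eq_self {x : ι → ℝ} (hx : x ∈ unitCube ι) : cubeProj x = x := by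
  funext i
  have h1 : -1 ≤ x i := hx.1 i
  have h2 : x i ≤ 1 := hx.2 i
  simp [cubeProj, min_eq_right h2, max_eq_right h1]

variable [Fintype ι]

theorem lipschitzWith_cubeProj : LipschitzWith 1 (cubeProj : (ι → ℝ) → ι → ℝ) := by
  refine LipschitzWith.of_dist_le_mul fun x y => ?_
  rw [NNReal.coe_one, one_mul, dist_pi_le_iff dist_nonneg]
  intro i
  refine le_trans ?_ (dist_le_pi_dist x y i)
  rw [Real.dist_eq, Real.dist_eq]
  have h1 := abs_max_sub_max_le_max (-1) (min 1 (x i)) (-1) (min 1 (y i))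
  have h2 := abs_min_sub_min_le_max 1 (x i) 1 (y i)
  simp only [sub_self, abs_zero, abs_nonneg, max_eq_right] at h1 h2
  exact h1.trans h2

theorem continuous_cubeProj : Continuous (cubeProj : (ι → ℝ) → ι → ℝ) :=
  lipschitzWith_cubeProj.continuous

theorem isCompact_unitCube {ι : Type*} : IsCompact (unitCube ι) := isCompact_Icc

/-- A small multiple of a perturbation that preserves the faces of the cube, added to the identity,
is a bijection of the cube. -/
theorem bijOn_unitCube_of_lipschitz {h : (ι → ℝ) → ι → ℝ} {K : NNReal} {t : ℝ} (ht : 0 ≤ t)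
    (ht1 : t ≤ 1) (hK : LipschitzOnWith K h (unitCube ι)) (htK : t * K < 1)
    (hmaps : ∀ x ∈ unitCube ι, x + h x ∈ unitCube ι)
    (hup : ∀ x ∈ unitCube ι, ∀ i, x i = 1 → h x i = 0)
    (hlow : ∀ x ∈ unitCube ι, ∀ i, x i = -1 → h x i = 0) :
    BijOn (fun x => x + t • h x) (unitCube ι) (unitCube ι) := by
  -- Solving `x + t • h x = y` in the cube is a fixed point problem; composing with `cubeProj` makes
  -- the map a contraction of the whole space.
  have hcontr : ∀ y : ι → ℝ, ContractingWith (t.toNNReal * K)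
      (fun x => y - t • h (cubeProj x)) := by
    intro y
    refine ⟨?_, LipschitzWith.of_dist_le_mul fun a b => ?_⟩
    · rw [← NNReal.coe_lt_coe]; simpa [ht] using htK
    · have h1 := hK.dist_le_mul _ (cubeProj_mem a) _ (cubeProj_mem b)
      have h2 := lipschitzWith_cubeProj.dist_le_mul a b
      rw [NNReal.coe_one, one_mul] at h2
      rw [dist_sub_left, dist_smul₀, Real.norm_of_nonneg ht, NNReal.coe_mul,
        Real.coe_toNNReal t ht, mul_assoc]
      gcongr
      exact h1.trans (by gcongr)
  refine ⟨fun x hx => ?_, fun x hx x' hx' hxx => ?_, fun y hy => ?_⟩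
  · have := (convex_Icc (-1 : ι → ℝ) 1) hx (hmaps x hx) (sub_nonneg.2 ht1) ht (by ring)
    rwa [smul_add, sub_smul, one_smul, ← add_assoc, sub_add_cancel] at this
  · refine (hcontr (x + t • h x)).fixedPoint_unique' ?_ ?_
    · simp [Function.IsFixedPt, cubeProj_eq_self hx]
    · change x + t • h x = x' + t • h x' at hxx
      rw [hxx]; simp [Function.IsFixedPt, cubeProj_eq_self hx']
  · set x := ContractingWith.fixedPoint _ (hcontr y) with hxdef
    have hfix : y - t • h (cubeProj x) = x := (hcontr y).fixedPoint_isFixedPt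
    have hy1 : ∀ i, y i - t * h (cubeProj x) i = x i := fun i => congrFun hfix i
    -- A coordinate outside `[-1, 1]` would be projected onto a face, where that component of `h`
    -- vanishes; then `x i = y i`, which lies in `[-1, 1]`.
    have hx : x ∈ unitCube ι := by
      constructor
      · intro i
        by_contra hlt
        have hlt : x i < -1 := not_le.1 hlt
        have hz : cubeProj x i = -1 := by
          simp only [cubeProj]; rw [min_eq_right (by linarith), max_eq_left hlt.le]
        have := hy1 i
        rw [hlow _ (cubeProj_mem x) i hz] at this
        have hyi : -1 ≤ y i := hy.1 i
        linarith
      · intro i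
        by_contra hlt
        have hlt : 1 < x i := not_le.1 hlt
        have hz : cubeProj x i = 1 := by
          simp only [cubeProj]; rw [min_eq_left hlt.le, max_eq_right (by norm_num)]
        have := hy1 i
        rw [hup _ (cubeProj_mem x) i hz] at this
        have hyi : y i ≤ 1 := hy.2 i
        linarith
    refine ⟨x, hx, ?_⟩
    rw [cubeProj_eq_self hx] at hfix
    exact (sub_eq_iff_eq_add.1 hfix).symm

/-- `det (1 + t B)` is a polynomial in `t` of degree at most the dimension. -/
theorem exists_polynomial_eval_eq_det (B : (ι → ℝ) →L[ℝ] ι → ℝ) :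
    ∃ p : Polynomial ℝ, p.natDegree ≤ Fintype.card ι ∧
      ∀ t : ℝ, p.eval t = (ContinuousLinearMap.id ℝ (ι → ℝ) + t • B).det := by
  classical
  refine ⟨_, Polynomial.natDegree_det_X_add_C_le (LinearMap.toMatrix' (B : (ι → ℝ) →ₗ[ℝ] ι → ℝ)) 1,
    fun t => ?_⟩
  rw [← Polynomial.coe_evalRingHom, RingHom.map_det, ContinuousLinearMap.det,
    ← LinearMap.det_toMatrix']
  congr 1
  ext i j
  by_cases hij : i = j <;>
    simp [LinearMap.toMatrix'_apply, hij, add_comm, mul_comm t]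

/-- A `C¹` self-map of the cube that preserves the faces has a point with invertible derivative. -/
theorem exists_det_fderiv_ne_zero {u : (ι → ℝ) → ι → ℝ} (hu : ContDiff ℝ 1 u)
    (hmaps : ∀ x ∈ unitCube ι, u x ∈ unitCube ι)
    (hup : ∀ x ∈ unitCube ι, ∀ i, x i = 1 → u x i = 1)
    (hlow : ∀ x ∈ unitCube ι, ∀ i, x i = -1 → u x i = -1) :
    ∃ x ∈ unitCube ι, (fderiv ℝ u x).det ≠ 0 := by
  classical
  by_contra! hdet
  -- The integral of `det (id + t h')` over the cube is polynomial in `t`. For small `t > 0` the map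
  -- `id + t h` is a bijection of the cube, so the integral is the volume; hence it is the volume at
  -- `t = 1` too, where the integrand is `det u' = 0`.
  set h : (ι → ℝ) → ι → ℝ := fun x => u x - x with hh
  have hC : ContDiff ℝ 1 h := hu.sub contDiff_id
  have hfd : ∀ x, fderiv ℝ h x = fderiv ℝ u x - ContinuousLinearMap.id ℝ (ι → ℝ) := by
    intro x
    exact ((hu.differentiable one_ne_zero x).hasFDerivAt.sub (hasFDerivAt_id x)).fderiv
  obtain ⟨K, hK⟩ := hC.contDiffOn.exists_lipschitzOnWith (s := unitCube ι) one_ne_zero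
    (convex_Icc _ _) isCompact_unitCube
  set D : ℝ → (ι → ℝ) → ℝ := fun t x =>
    (ContinuousLinearMap.id ℝ (ι → ℝ) + t • fderiv ℝ h x).det with hD
  have hDc : Continuous (fun z : ℝ × (ι → ℝ) => D z.1 z.2) := by
    refine ContinuousLinearMap.continuous_det.comp ?_
    exact continuous_const.add (continuous_fst.smul
      ((hC.continuous_fderiv one_ne_zero).comp continuous_snd))
  have hpos : ∀ᶠ t in 𝓝 (0 : ℝ), ∀ x ∈ unitCube ι, 0 < D t x := by
    refine isCompact_unitCube.eventually_forall_of_forall_eventually fun x _ => ?_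
    refine hDc.continuousAt.eventually (lt_mem_nhds ?_)
    simp [hD, ContinuousLinearMap.det]
  have hsmall : ∀ᶠ t : ℝ in 𝓝 0, t * (K : ℝ) < 1 :=
    (continuous_id.mul continuous_const).continuousAt.eventually (gt_mem_nhds (by simp))
  obtain ⟨t₀, ht₀, hball⟩ := Metric.eventually_nhds_iff.1 ((hpos.and hsmall).and (gt_mem_nhds one_pos))
  have hvol : ∀ t, 0 < t → t < t₀ →
      ∫ x in unitCube ι, D t x = (volume : Measure (ι → ℝ)).real (unitCube ι) := by
    intro t ht htt
    obtain ⟨⟨hp, hs⟩, h1⟩ := hball (y := t) (by rw [Real.dist_eq, sub_zero, abs_of_pos ht]; exact htt)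
    have hbij := bijOn_unitCube_of_lipschitz (h := h) ht.le h1.le hK hs
      (fun x hx => by simpa [hh] using hmaps x hx)
      (fun x hx i hi => by simp [hh, hi, hup x hx i hi])
      (fun x hx i hi => by simp [hh, hi, hlow x hx i hi])
    have hcv := integral_image_eq_integral_abs_det_fderiv_smul (volume : Measure (ι → ℝ))
      (s := unitCube ι) (f := fun x => x + t • h x)
      (f' := fun x => ContinuousLinearMap.id ℝ (ι → ℝ) + t • fderiv ℝ h x)
      measurableSet_Icc
      (fun x _ => ((hasFDerivAt_id x).add
        (((hC.differentiable one_ne_zero) x).hasFDerivAt.const_smul t)).hasFDerivWithinAt)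
      hbij.injOn (fun _ => (1 : ℝ))
    rw [hbij.image_eq] at hcv
    simp only [smul_eq_mul, mul_one, integral_const, measureReal_restrict_apply_univ] at hcv
    rw [hcv]
    refine setIntegral_congr_fun measurableSet_Icc fun x hx => ?_
    exact (abs_of_pos (hp x hx)).symm
  set s : Finset ℕ := Finset.range (Fintype.card ι + 1) with hs
  -- Interpolation nodes, one more than the dimension; the shift by 2 keeps all of them strictly
  -- below `t₀`.
  set v : ℕ → ℝ := fun k => t₀ / (k + 2) with hv
  have hvinj : InjOn v s := by
    intro a _ b _ hab
    simp only [hv] at hab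
    have ha : (a : ℝ) + 2 ≠ 0 := by positivity
    have hb : (b : ℝ) + 2 ≠ 0 := by positivity
    rw [div_eq_div_iff ha hb] at hab
    have := mul_left_cancel₀ ht₀.ne' hab
    exact_mod_cast (by linarith : (a : ℝ) = b)
  have hinterp : ∀ x, D 1 x = ∑ k ∈ s, D (v k) x * (Lagrange.basis s v k).eval 1 := by
    intro x
    obtain ⟨p, hpd, hpe⟩ := exists_polynomial_eval_eq_det (fderiv ℝ h x)
    have hlt : p.degree < (s.card : WithBot ℕ) := by
      rw [hs, Finset.card_range]
      exact (Polynomial.degree_le_of_natDegree_le hpd).trans_lt (by exact_mod_cast Nat.lt_succ_self _)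
    have := congrArg (Polynomial.eval 1) (Lagrange.eq_interpolate hvinj hlt)
    rw [hpe, Lagrange.interpolate_apply, Polynomial.eval_finsetSum] at this
    simpa [hpe, hD] using this
  have hint : ∀ t, Integrable (D t) (volume.restrict (unitCube ι)) := fun t =>
    ((hDc.comp (Continuous.prodMk_right t)).continuousOn.integrableOn_compact isCompact_unitCube)
  have hbasis : ∑ k ∈ s, (Lagrange.basis s v k).eval 1 = 1 := by
    have := congrArg (Polynomial.eval 1) (Lagrange.sum_basis hvinj (by simp [hs]))
    simpa [Polynomial.eval_finsetSum] using this
  have hzero : ∫ x in unitCube ι, D 1 x = 0 := by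
    rw [← integral_zero (ι → ℝ) ℝ (μ := volume.restrict (unitCube ι))]
    refine setIntegral_congr_fun measurableSet_Icc fun x hx => ?_
    simp only [hD, hfd, one_smul]
    rw [add_sub_cancel]
    exact hdet x hx
  have hone : ∫ x in unitCube ι, D 1 x = (volume : Measure (ι → ℝ)).real (unitCube ι) := by
    simp_rw [hinterp]
    rw [integral_finsetSum _ fun k _ => (hint (v k)).mul_const _]
    simp_rw [integral_mul_const]
    rw [Finset.sum_congr rfl fun k _ => by
      rw [hvol (v k) (by positivity) (div_lt_self ht₀ (by
        have : (0 : ℝ) ≤ k := k.cast_nonneg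
        linarith))], ← Finset.mul_sum, hbasis, mul_one]
  have hvolpos : 0 < (volume : Measure (ι → ℝ)).real (unitCube ι) := by
    rw [unitCube, measureReal_def, Real.volume_Icc_pi_toReal (fun i => by simp)]
    exact Finset.prod_pos fun i _ => by norm_num
  linarith

/-- **Poincaré–Miranda theorem**. -/
theorem exists_eq_zero_of_signs_on_faces {F : (ι → ℝ) → ι → ℝ} (hF : ContinuousOn F (unitCube ι))
    (hup : ∀ x ∈ unitCube ι, ∀ i, x i = 1 → 0 < F x i)
    (hlow : ∀ x ∈ unitCube ι, ∀ i, x i = -1 → F x i < 0) :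
    ∃ x ∈ unitCube ι, F x = 0 := by
  classical
  by_contra! hne
  have hFc : ∀ i, ContinuousOn (fun x => F x i) (unitCube ι) := fun i =>
    (continuous_apply i).comp_continuousOn hF
  have key : ∀ (S : Set (ι → ℝ)) (φ : (ι → ℝ) → ℝ), IsCompact S → ContinuousOn φ S →
      (∀ x ∈ S, 0 < φ x) → ∃ δ > 0, ∀ x ∈ S, δ ≤ φ x := by
    intro S φ hS hφ hpos
    rcases S.eq_empty_or_nonempty with rfl | hne
    · exact ⟨1, one_pos, by simp⟩
    · obtain ⟨x, hx, hmin⟩ := hS.exists_isMinOn hne hφ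
      exact ⟨φ x, hpos x hx, fun y hy => hmin hy⟩
  have hface : ∀ (i : ι) (c : ℝ), IsCompact (unitCube ι ∩ {x | x i = c}) := fun i c =>
    isCompact_unitCube.inter_right (isClosed_eq (continuous_apply i) continuous_const)
  obtain ⟨δ₀, hδ₀, h0⟩ := key _ (fun x => ‖F x‖) isCompact_unitCube hF.norm
    (fun x hx => norm_pos_iff.2 (hne x hx))
  choose δ₁ hδ₁ h1 using fun i => key _ (fun x => F x i) (hface i 1)
    ((hFc i).mono inter_subset_left) (fun x hx => hup x hx.1 i hx.2)
  choose δ₂ hδ₂ h2 using fun i => key _ (fun x => -F x i) (hface i (-1))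
    ((hFc i).mono inter_subset_left).neg (fun x hx => neg_pos.2 (hlow x hx.1 i hx.2))
  obtain ⟨δ, hδ, hδ0, hδ1, hδ2⟩ : ∃ δ > 0, δ ≤ δ₀ ∧ (∀ i, δ ≤ δ₁ i) ∧ ∀ i, δ ≤ δ₂ i := by
    have e : ∀ c > (0 : ℝ), ∀ᶠ δ in 𝓝[>] (0 : ℝ), δ ≤ c := fun c hc =>
      mem_nhdsWithin_of_mem_nhds (Iic_mem_nhds hc)
    obtain ⟨δ, h⟩ := ((eventually_mem_nhdsWithin (s := Ioi (0 : ℝ)) (a := 0)).and ((e _ hδ₀).and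
      ((eventually_all.2 fun i => e _ (hδ₁ i)).and (eventually_all.2 fun i => e _ (hδ₂ i))))).exists
    exact ⟨δ, h.1, h.2.1, h.2.2.1, h.2.2.2⟩
  -- Composing with `cubeProj` extends `F` continuously to the whole space before smoothing.
  obtain ⟨G, hG, hGF, -⟩ := Continuous.exists_contDiff_approx (E := ι → ℝ) (F := ι → ℝ) 1
    (f := fun x => F (cubeProj x)) (ε := fun _ => δ / 2)
    (hF.comp_continuous continuous_cubeProj cubeProj_mem) continuous_const (fun _ => half_pos hδ)
  have hGF' : ∀ x ∈ unitCube ι, ∀ i, |G x i - F x i| < δ / 2 := by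
    intro x hx i
    have := hGF x
    simp only [cubeProj_eq_self hx] at this
    exact (dist_le_pi_dist (G x) (F x) i).trans_lt this
  -- A smooth step from -1 to 1, constant outside `[-δ/2, δ/2]`. Applied to the coordinates of `G`
  -- it gives a face-preserving self-map of the cube.
  set H : ℝ → ℝ := fun r => 2 * Real.smoothTransition ((r / (δ / 2) + 1) / 2) - 1 with hH
  have hHc : ContDiff ℝ 1 H := by
    have : ContDiff ℝ 1 Real.smoothTransition := Real.smoothTransition.contDiff
    exact (contDiff_const.mul (this.comp (by fun_prop))).sub contDiff_const
  have hH1 : ∀ r, δ / 2 < r → H r = 1 := by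
    intro r hr
    have : 1 ≤ (r / (δ / 2) + 1) / 2 := by
      have := (one_le_div (half_pos hδ)).2 hr.le
      linarith
    simp only [hH]
    rw [Real.smoothTransition.one_of_one_le this]
    norm_num
  have hH2 : ∀ r, r < -(δ / 2) → H r = -1 := by
    intro r hr
    have : (r / (δ / 2) + 1) / 2 ≤ 0 := by
      have := (div_le_iff₀ (half_pos hδ)).2 (show r ≤ (-1) * (δ / 2) by linarith)
      linarith
    simp only [hH]
    rw [Real.smoothTransition.zero_of_nonpos this]
    norm_num
  have hu : ContDiff ℝ 1 (fun x i => H (G x i)) :=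
    contDiff_pi.2 fun i => hHc.comp ((contDiff_pi.1 hG) i)
  obtain ⟨x, hx, hdet⟩ := exists_det_fderiv_ne_zero hu
    (fun x _ => ⟨fun i => by
        have := Real.smoothTransition.nonneg ((G x i / (δ / 2) + 1) / 2)
        simp only [hH, Pi.neg_apply, Pi.one_apply]; linarith,
      fun i => by
        have := Real.smoothTransition.le_one ((G x i / (δ / 2) + 1) / 2)
        simp only [hH, Pi.one_apply]; linarith⟩)
    (fun x hx i hi => hH1 _ (by
      have := (abs_lt.1 (hGF' x hx i)).1
      have := h1 i x ⟨hx, hi⟩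
      have := hδ1 i
      linarith))
    (fun x hx i hi => hH2 _ (by
      have := (abs_lt.1 (hGF' x hx i)).2
      have := h2 i x ⟨hx, hi⟩
      have := hδ2 i
      linarith))
  obtain ⟨i, hi⟩ : ∃ i, δ ≤ |F x i| := by
    by_contra! hlt
    have := (pi_norm_lt_iff hδ (x := F x)).2 hlt
    linarith [h0 x hx]
  have hbig : δ / 2 < |G x i| := by
    have := abs_sub_abs_le_abs_sub (F x i) (G x i)
    rw [abs_sub_comm] at this
    linarith [hGF' x hx i]
  have hGi : Continuous fun y => G y i := (continuous_apply i).comp hG.continuous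
  -- Since `G x i` lies outside the transition zone, the `i`-th component is locally constant, so
  -- the Jacobian has a zero row.
  obtain ⟨c, hc⟩ : ∃ c, (fun y => H (G y i)) =ᶠ[𝓝 x] fun _ => c := by
    rcases lt_abs.1 hbig with h | h
    · exact ⟨1, (hGi.continuousAt.eventually (lt_mem_nhds h)).mono fun y hy => hH1 _ hy⟩
    · exact ⟨-1, (hGi.continuousAt.eventually (gt_mem_nhds (lt_neg.1 h))).mono
        fun y hy => hH2 _ hy⟩
  have hder : ∀ w, fderiv ℝ (fun x i => H (G x i)) x w i = 0 := by
    intro w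
    have hd := hasFDerivAt_pi'.1 (hu.differentiable one_ne_zero x).hasFDerivAt i
    have := hd.unique ((hasFDerivAt_const c x).congr_of_eventuallyEq hc)
    exact DFunLike.congr_fun this w
  refine hdet ?_
  rw [ContinuousLinearMap.det, ← LinearMap.det_toMatrix']
  refine Matrix.det_eq_zero_of_row_eq_zero i fun j => ?_
  rw [LinearMap.toMatrix'_apply]
  exact hder _

end PoincareMiranda

/-! ### Closedness of finitely generated cones and the polytope case. -/

section FinitelyGeneratedCone

namespace PointedCone

theorem mem_hull_finset {E : Type*} [AddCommGroup E] [Module ℝ E] {t : Finset E} {x : E} :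
    x ∈ hull ℝ (t : Set E) ↔ ∃ c : E → ℝ, (∀ e ∈ t, 0 ≤ c e) ∧ ∑ e ∈ t, c e • e = x := by
  constructor
  · rw [mem_hull_set]
    rintro ⟨c, hc, hc0, rfl⟩
    refine ⟨c, fun e _ => hc0 e, ?_⟩
    rw [Finsupp.sum_of_support_subset c (by exact_mod_cast hc) _ (by simp)]
  · rintro ⟨c, hc, rfl⟩
    exact Submodule.sum_mem _ fun e he => (hull ℝ (t : Set E)).smul_mem (hc e he) (subset_hull he)

/-- **Carathéodory's theorem** for cones. -/
theorem exists_linearIndepOn_mem_hull {E : Type*} [AddCommGroup E] [Module ℝ E] {s : Set E}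
    {x : E} (hx : x ∈ hull ℝ s) :
    ∃ t : Finset E, ↑t ⊆ s ∧ LinearIndepOn ℝ id (t : Set E) ∧ x ∈ hull ℝ (t : Set E) := by
  classical
  have hex : ∃ t : Finset E, (t : Set E) ⊆ s ∧ x ∈ hull ℝ (t : Set E) := by
    obtain ⟨c, hc, hc0, hcx⟩ := mem_hull_set.1 hx
    exact ⟨c.support, hc, mem_hull_set.2 ⟨c, subset_rfl, hc0, hcx⟩⟩
  obtain ⟨t, ⟨hts, hxt⟩, hmin⟩ := WellFounded.has_min (measure Finset.card).wf
    {t : Finset E | (t : Set E) ⊆ s ∧ x ∈ hull ℝ (t : Set E)} hex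
  refine ⟨t, hts, ?_, hxt⟩
  by_contra hdep
  obtain ⟨c, hc, hcx⟩ := mem_hull_finset.1 hxt
  obtain ⟨g, hg, e₁, he₁, hge₁⟩ : ∃ g : E → ℝ, ∑ e ∈ t, g e • e = 0 ∧ ∃ e ∈ t, 0 < g e := by
    rw [linearIndepOn_finset_iff] at hdep
    push Not at hdep
    obtain ⟨g, hg, e, he, hne⟩ := hdep
    rcases hne.lt_or_gt with h | h
    · exact ⟨-g, by simpa using hg, e, he, by simpa using h⟩
    · exact ⟨g, hg, e, he, h⟩
  -- The least ratio `c e / g e` is the largest multiple of the relation `g` that can be subtracted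
  -- while keeping the coefficients nonnegative; it removes `e₀`, against minimality of `t`.
  obtain ⟨e₀, he₀, hle⟩ := (t.filter (0 < g ·)).exists_min_image (fun e => c e / g e)
    ⟨e₁, Finset.mem_filter.2 ⟨he₁, hge₁⟩⟩
  obtain ⟨he₀t, hg₀⟩ := Finset.mem_filter.1 he₀
  refine hmin (t.erase e₀) ⟨(Finset.coe_subset.2 (t.erase_subset e₀)).trans hts, ?_⟩
    (Finset.card_erase_lt_of_mem he₀t)
  refine mem_hull_finset.2 ⟨fun e => c e - c e₀ / g e₀ * g e, fun e he => ?_, ?_⟩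
  · have het := Finset.mem_of_mem_erase he
    have hq : 0 ≤ c e₀ / g e₀ := div_nonneg (hc _ he₀t) hg₀.le
    rcases le_or_gt (g e) 0 with h | h
    · have := mul_nonpos_of_nonneg_of_nonpos hq h
      linarith [hc e het]
    · have := (le_div_iff₀ h).1 (hle e (Finset.mem_filter.2 ⟨het, h⟩))
      linarith
  · rw [Finset.sum_erase _ (by
      beta_reduce; rw [div_mul_cancel₀ _ hg₀.ne', sub_self, zero_smul])]
    simp_rw [sub_smul, mul_smul]
    rw [Finset.sum_sub_distrib, ← Finset.smul_sum, hg, hcx, smul_zero, sub_zero]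

variable {E : Type*} [AddCommGroup E] [Module ℝ E] [TopologicalSpace E]
  [IsTopologicalAddGroup E] [ContinuousSMul ℝ E] [T2Space E]

/-- The cone is the image of a closed orthant under an injective linear map from a finite
dimensional space, which is a closed embedding. -/
theorem isClosed_hull_of_linearIndepOn {t : Finset E} (ht : LinearIndepOn ℝ id (t : Set E)) :
    IsClosed (hull ℝ (t : Set E) : Set E) := by
  have hinj : (Fintype.linearCombination ℝ (fun e : t => (e : E))).ker = ⊥ :=
    LinearMap.ker_eq_bot.2 (linearIndependent_iff_injective_fintypeLinearCombination.1 ht)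
  have hcl := (LinearMap.isClosedEmbedding_of_injective hinj).isClosedMap _
    (isClosed_Ici (a := (0 : t → ℝ)))
  convert hcl using 1
  ext x
  rw [SetLike.mem_coe, mem_hull_finset]
  constructor
  · rintro ⟨c, hc, rfl⟩
    refine ⟨fun e => c e, fun e => hc e e.2, ?_⟩
    rw [Fintype.linearCombination_apply]
    exact Finset.sum_coe_sort t fun e => c e • e
  · classical
    rintro ⟨c, hc, rfl⟩
    refine ⟨fun e => if h : e ∈ t then c ⟨e, h⟩ else 0, fun e he => by simpa [he] using hc ⟨e, he⟩, ?_⟩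
    rw [Fintype.linearCombination_apply, ← Finset.sum_coe_sort t]
    simp

/-- Finitely generated cones in a Hausdorff topological vector space are closed. -/
theorem isClosed_hull_of_finite {s : Set E} (hs : s.Finite) : IsClosed (hull ℝ s : Set E) := by
  have h : (hull ℝ s : Set E) = ⋃ t ∈ {t : Finset E | (t : Set E) ⊆ s ∧
      LinearIndepOn ℝ id (t : Set E)}, (hull ℝ (t : Set E) : Set E) := by
    ext x
    simp only [mem_iUnion, exists_prop, mem_ofPred_eq, SetLike.mem_coe]
    constructor
    · intro hx
      obtain ⟨t, h1, h2, h3⟩ := exists_linearIndepOn_mem_hull hx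
      exact ⟨t, ⟨h1, h2⟩, h3⟩
    · rintro ⟨t, ⟨h1, -⟩, h3⟩
      exact Submodule.span_mono h1 h3
  rw [h]
  refine Set.Finite.isClosed_biUnion ?_ fun t ht => isClosed_hull_of_linearIndepOn ht.2
  exact (hs.toFinset.powerset.finite_toSet).subset fun t ht => by
    simpa using ht.1

omit [TopologicalSpace E] [IsTopologicalAddGroup E] [ContinuousSMul ℝ E] [T2Space E] in
theorem hull_convexHull (s : Set E) : hull ℝ (convexHull ℝ s) = hull ℝ s :=
  le_antisymm (Submodule.span_le.2 (convexHull_min subset_hull (hull ℝ s).convex))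
    (Submodule.span_mono (subset_convexHull ℝ s))

end PointedCone

namespace Quasidiff

theorem IsPolytope.add_singleton {E : Type*} [AddCommGroup E] [Module ℝ E] {S : Set E}
    (hS : IsPolytope S) (a : E) : IsPolytope (S + {a}) := by
  obtain ⟨F, hF, rfl⟩ := hS
  exact ⟨F + {a}, hF.add (finite_singleton a), by rw [convexHull_add, convexHull_singleton]⟩

theorem IsPolytope.singleton_sub {E : Type*} [AddCommGroup E] [Module ℝ E] {S : Set E}
    (hS : IsPolytope S) (a : E) : IsPolytope ({a} - S) := by
  obtain ⟨F, hF, rfl⟩ := hS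
  exact ⟨{a} - F, (finite_singleton a).sub hF, by rw [convexHull_sub, convexHull_singleton]⟩

theorem isClosed_hull_iUnion_of_isPolytope {κ E : Type*} [Finite κ] [AddCommGroup E] [Module ℝ E]
    [TopologicalSpace E] [IsTopologicalAddGroup E] [ContinuousSMul ℝ E] [T2Space E]
    {S : κ → Set E} (hS : ∀ k, IsPolytope (S k)) :
    IsClosed (PointedCone.hull ℝ (⋃ k, S k) : Set E) := by
  choose F hF hSF using hS
  obtain rfl : S = fun k => convexHull ℝ (F k) := funext hSF
  have : PointedCone.hull ℝ (⋃ k, convexHull ℝ (F k)) = PointedCone.hull ℝ (⋃ k, F k) := by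
    simp only [PointedCone.hull, Submodule.span_iUnion]
    exact iSup_congr fun k => PointedCone.hull_convexHull (F k)
  rw [this]
  exact PointedCone.isClosed_hull_of_finite (finite_iUnion hF)

theorem constraintCone_eq {X : Type*} [NormedAddCommGroup X] [NormedSpace ℝ X] {m : ℕ}
    (A B : Fin m → Set (WeakDual ℝ X)) (x y : Fin m → WeakDual ℝ X) :
    constraintCone A B x y = (PointedCone.hull ℝ (⋃ k : Fin m ⊕ Fin m,
      Sum.elim (fun i => A i + {y i}) (fun i => {-x i} - B i) k) : Set (WeakDual ℝ X)) := by
  rw [constraintCone, iUnion_sum, ← iUnion_union_distrib]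
  rfl

theorem isClosed_constraintCone_of_isPolytope {X : Type*} [NormedAddCommGroup X] [NormedSpace ℝ X]
    {m : ℕ} {A B : Fin m → Set (WeakDual ℝ X)} (x y : Fin m → WeakDual ℝ X)
    (hAB : ∀ i, IsPolytope (A i) ∧ IsPolytope (B i)) : IsClosed (constraintCone A B x y) := by
  rw [constraintCone_eq]
  refine isClosed_hull_iUnion_of_isPolytope ?_
  rintro (i | i)
  · exact (hAB i).1.add_singleton _
  · exact (hAB i).2.singleton_sub _

end Quasidiff

end FinitelyGeneratedCone

namespace Quasidiff

/-! ### Directional derivatives and quasidifferentials. -/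

section DirectionalDerivatives

variable {X : Type*} [NormedAddCommGroup X] [NormedSpace ℝ X] {f : X → ℝ} {x v : X}

theorem HasDirDerivAt.neg {d : ℝ} (h : HasDirDerivAt f x v d) :
    HasDirDerivAt (fun x => -f x) x v (-d) :=
  (Tendsto.neg h).congr fun α => by ring

theorem DirDiffUnifFinDimAt.neg (h : DirDiffUnifFinDimAt f x) :
    DirDiffUnifFinDimAt (fun x => -f x) x := fun v => by
  obtain ⟨d, hd, hX⟩ := h v
  exact ⟨-d, hd.neg, fun X₀ hX₀ => (hX X₀ hX₀).neg.congr fun p => by ring⟩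

theorem eventually_forall_mem_of_mem_nhds {T : Type*} [TopologicalSpace T] {S : Set T}
    (hS : IsCompact S) {u : T → X} (hu : Continuous u) {N : Set X} (hN : N ∈ 𝓝 x) :
    ∀ᶠ α in 𝓝 (0 : ℝ), ∀ τ ∈ S, x + α • u τ ∈ N := by
  refine hS.eventually_forall_of_forall_eventually fun τ _ => ?_
  have hc : Continuous fun z : ℝ × T => x + z.1 • u z.2 := by fun_prop
  exact hc.continuousAt.preimage_mem_nhds (by simpa using hN)

/-- If `f` decreases to first order in all directions of a finite dimensional compact family, then
it decreases along all of them for the same step size. -/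
theorem DirDiffUnifFinDimAt.eventually_forall_lt {T : Type*} [TopologicalSpace T] {S : Set T}
    (hf : DirDiffUnifFinDimAt f x) (hS : IsCompact S) {u : T → X} (hu : Continuous u)
    {X₀ : Submodule ℝ X} (hX₀ : FiniteDimensional ℝ X₀) (huX : ∀ τ, u τ - v ∈ X₀)
    (hneg : ∀ τ ∈ S, ∀ d, HasDirDerivAt f x (u τ) d → d < 0) :
    ∀ᶠ α in 𝓝[>] (0 : ℝ), ∀ τ ∈ S, f (x + α • u τ) < f x := by
  -- Moving `0 < α` into the claim turns the filter into a full neighbourhood filter, to which the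
  -- compactness argument applies.
  suffices h : ∀ᶠ α in 𝓝 (0 : ℝ), ∀ τ ∈ S, 0 < α → f (x + α • u τ) < f x from
    eventually_nhdsWithin_iff.2 (h.mono fun α hα hpos τ hτ => hα τ hτ hpos)
  refine hS.eventually_forall_of_forall_eventually fun τ hτ => ?_
  obtain ⟨d, hd, hX⟩ := hf (u τ)
  have hmap : Tendsto (fun z : ℝ × T => (z.1, u z.2)) (𝓝[>] (0 : ℝ) ×ˢ 𝓝 τ)
      (𝓝[>] (0 : ℝ) ×ˢ 𝓝[{v' : X | v' - u τ ∈ X₀}] (u τ)) := by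
    refine tendsto_fst.prodMk (tendsto_nhdsWithin_iff.2 ⟨(hu.tendsto τ).comp tendsto_snd, ?_⟩)
    refine Eventually.of_forall fun z => ?_
    have := X₀.sub_mem (huX z.2) (huX τ)
    simpa using this
  have hlt := ((hX X₀ hX₀).comp hmap).eventually (gt_mem_nhds (hneg τ hτ d hd))
  rw [← nhdsWithin_univ τ, ← nhdsWithin_prod_eq, eventually_nhdsWithin_iff] at hlt
  refine hlt.mono fun z hz hpos => ?_
  have := hz ⟨hpos, mem_univ _⟩
  simp only [Function.comp_apply] at this
  rcases div_neg_iff.1 this with h | h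
  · exact absurd h.2 (not_lt.2 hpos.le)
  · linarith [h.1]

theorem hasDirDerivAt_of_tendsto_prod {d : ℝ}
    (hd : Tendsto (fun p : ℝ × X => (f (x + p.1 • p.2) - f x) / p.1)
      (𝓝[>] (0 : ℝ) ×ˢ 𝓝 v) (𝓝 d)) : HasDirDerivAt f x v d := by
  have hpair : Tendsto (fun α : ℝ => (α, v)) (𝓝[>] 0) (𝓝[>] (0 : ℝ) ×ˢ 𝓝 v) :=
    tendsto_id.prodMk tendsto_const_nhds
  have hcomp := hd.comp hpair
  exact hcomp

theorem HadamardDirDiffAt.eventually_lt {d : ℝ} (hf : HadamardDirDiffAt f x)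
    (hd : HasDirDerivAt f x v d) (hneg : d < 0) :
    ∀ᶠ p in 𝓝[>] (0 : ℝ) ×ˢ 𝓝 v, f (x + p.1 • p.2) < f x := by
  obtain ⟨d', hd'⟩ := hf v
  obtain rfl : d = d' := tendsto_nhds_unique hd (hasDirDerivAt_of_tendsto_prod hd')
  have hpos : ∀ᶠ p in 𝓝[>] (0 : ℝ) ×ˢ 𝓝 v, 0 < p.1 :=
    tendsto_fst.eventually (eventually_mem_nhdsWithin (s := Ioi (0 : ℝ)) (a := 0))
  refine ((hd'.eventually (gt_mem_nhds hneg)).and hpos).mono fun p hp => ?_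
  rcases div_neg_iff.1 hp.1 with h | h
  · exact absurd h.2 (not_lt.2 hp.2.le)
  · linarith [h.1]

variable {A B : Set (WeakDual ℝ X)}

/-- Replacing the minimum over `B` by its value at `b` only increases the derivative, and strictness
survives because the maximum over `A` is attained. -/
theorem IsQuasidifferentialAt.hasDirDerivAt_neg (h : IsQuasidifferentialAt f x A B)
    {b : WeakDual ℝ X} (hb : b ∈ B) (hv : ∀ φ ∈ A + {b}, φ v < 0) {d : ℝ}
    (hd : HasDirDerivAt f x v d) : d < 0 := by
  obtain ⟨a', b', ⟨⟨φ, hφ, rfl⟩, -⟩, ⟨-, hb'⟩, h'⟩ := h.dirDeriv v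
  rw [tendsto_nhds_unique hd h']
  have h1 : b' ≤ b v := hb' ⟨b, hb, rfl⟩
  have h2 : φ v + b v < 0 := hv _ (add_mem_add hφ rfl)
  simp only
  linarith

theorem IsQuasidifferentialAt.hasDirDerivAt_pos (h : IsQuasidifferentialAt f x A B)
    {a : WeakDual ℝ X} (ha : a ∈ A) (hv : ∀ φ ∈ {-a} - B, φ v < 0) {d : ℝ}
    (hd : HasDirDerivAt f x v d) : 0 < d := by
  obtain ⟨a', b', ⟨-, ha'⟩, ⟨⟨φ, hφ, rfl⟩, -⟩, h'⟩ := h.dirDeriv v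
  rw [tendsto_nhds_unique hd h']
  have h1 : a v ≤ a' := ha' ⟨a, ha, rfl⟩
  have h2 : -a v - φ v < 0 := hv _ (sub_mem_sub rfl hφ)
  simp only
  linarith

theorem IsQuasidifferentialAt.nonempty_sub (h : IsQuasidifferentialAt f x A B) : A.Nonempty := by
  obtain ⟨a, b, ⟨⟨φ, hφ, -⟩, -⟩, -⟩ := h.dirDeriv 0
  exact ⟨φ, hφ⟩

theorem IsQuasidifferentialAt.nonempty_sup (h : IsQuasidifferentialAt f x A B) : B.Nonempty := by
  obtain ⟨a, b, -, ⟨⟨φ, hφ, -⟩, -⟩, -⟩ := h.dirDeriv 0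
  exact ⟨φ, hφ⟩

theorem le_supportFn {C : Set (WeakDual ℝ X)} (hC : IsCompact C) {φ : WeakDual ℝ X} (hφ : φ ∈ C)
    (v : X) : φ v ≤ supportFn C v :=
  le_csSup (hC.image (WeakDual.eval_continuous v)).bddAbove ⟨φ, hφ, rfl⟩

end DirectionalDerivatives

/-! ### Correcting a direction to satisfy the equality constraints. -/

section Descent

variable {X : Type*} [NormedAddCommGroup X] [NormedSpace ℝ X]

/-- The piecewise linear map sending `τ` to `∑ i, τ i⁺ v i + τ i⁻ w i`. -/
def cornerMap {ι : Type*} [Fintype ι] (v w : ι → X) (τ : ι → ℝ) : X :=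
  ∑ i, (max (τ i) 0 • v i + max (-τ i) 0 • w i)

variable {ι : Type*} [Fintype ι] {v w : ι → X}

theorem continuous_cornerMap (v w : ι → X) : Continuous (cornerMap v w) := by
  unfold cornerMap
  fun_prop

theorem apply_cornerMap (φ : WeakDual ℝ X) (τ : ι → ℝ) :
    φ (cornerMap v w τ) = ∑ i, (max (τ i) 0 * φ (v i) + max (-τ i) 0 * φ (w i)) := by
  simp [cornerMap, map_sum]

theorem cornerMap_mem_span (τ : ι → ℝ) :
    cornerMap v w τ ∈ Submodule.span ℝ (range v ∪ range w) :=
  Submodule.sum_mem _ fun i _ => Submodule.add_mem _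
    (Submodule.smul_mem _ _ (Submodule.subset_span (Or.inl ⟨i, rfl⟩)))
    (Submodule.smul_mem _ _ (Submodule.subset_span (Or.inr ⟨i, rfl⟩)))

/-- On the face `τ i = 1` the coefficient of `w i` is zero, and `w i` is the one vector at which the
sign of `φ` is not controlled. -/
theorem apply_cornerMap_neg_of_eq_one {φ : WeakDual ℝ X} {τ : ι → ℝ} {i : ι} (hτ : τ i = 1)
    (hi : φ (v i) < 0) (hv : ∀ k, k ≠ i → φ (v k) ≤ 0) (hw : ∀ k, k ≠ i → φ (w k) ≤ 0) :
    φ (cornerMap v w τ) < 0 := by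
  rw [apply_cornerMap]
  refine (Finset.sum_lt_sum (g := fun _ => 0) (fun k _ => ?_)
    ⟨i, Finset.mem_univ i, by simp [hτ, hi]⟩).trans_eq Finset.sum_const_zero
  by_cases hk : k = i
  · subst hk; simpa [hτ] using hi.le
  · exact add_nonpos (mul_nonpos_of_nonneg_of_nonpos (le_max_right _ _) (hv k hk))
      (mul_nonpos_of_nonneg_of_nonpos (le_max_right _ _) (hw k hk))

theorem apply_cornerMap_neg_of_eq_neg_one {φ : WeakDual ℝ X} {τ : ι → ℝ} {i : ι} (hτ : τ i = -1)
    (hi : φ (w i) < 0) (hv : ∀ k, k ≠ i → φ (v k) ≤ 0) (hw : ∀ k, k ≠ i → φ (w k) ≤ 0) :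
    φ (cornerMap v w τ) < 0 := by
  rw [apply_cornerMap]
  refine (Finset.sum_lt_sum (g := fun _ => 0) (fun k _ => ?_)
    ⟨i, Finset.mem_univ i, by simp [hτ, hi]⟩).trans_eq Finset.sum_const_zero
  by_cases hk : k = i
  · subst hk; simpa [hτ] using hi.le
  · exact add_nonpos (mul_nonpos_of_nonneg_of_nonpos (le_max_right _ _) (hv k hk))
      (mul_nonpos_of_nonneg_of_nonpos (le_max_right _ _) (hw k hk))

/-- Although `φ` ranges over a weak* compact set, the expression is jointly continuous in `(ε, φ,
τ)` because it involves only finitely many evaluations of `φ`. -/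
theorem eventually_forall_apply_neg {R : Set (WeakDual ℝ X)} (hR : IsCompact R) {u : X}
    (hu : ∀ φ ∈ R, φ u < 0) :
    ∀ᶠ ε in 𝓝 (0 : ℝ), ∀ τ ∈ unitCube ι, ∀ φ ∈ R, φ (u + ε • cornerMap v w τ) < 0 := by
  have h : ∀ᶠ ε in 𝓝 (0 : ℝ), ∀ p ∈ R ×ˢ unitCube ι, p.1 (u + ε • cornerMap v w p.2) < 0 := by
    refine (hR.prod isCompact_unitCube).eventually_forall_of_forall_eventually fun p hp => ?_
    have hev : ∀ y : X, Continuous fun z : ℝ × WeakDual ℝ X × (ι → ℝ) => z.2.1 y := fun y =>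
      (WeakDual.eval_continuous y).comp (continuous_fst.comp continuous_snd)
    have hc : Continuous fun z : ℝ × WeakDual ℝ X × (ι → ℝ) =>
        z.2.1 (u + z.1 • cornerMap v w z.2.2) := by
      simp only [map_add, map_smul, apply_cornerMap, smul_eq_mul]
      refine (hev u).add (continuous_fst.mul (continuous_finsetSum _ fun i _ => ?_))
      exact ((by fun_prop : Continuous fun z : ℝ × WeakDual ℝ X × (ι → ℝ) =>
          max (z.2.2 i) 0).mul (hev _)).add
        ((by fun_prop : Continuous fun z : ℝ × WeakDual ℝ X × (ι → ℝ) =>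
          max (-z.2.2 i) 0).mul (hev _))
    exact hc.continuousAt.eventually (gt_mem_nhds (by simpa using hu p.1 hp.1))
  exact h.mono fun ε hε τ hτ φ hφ => hε (φ, τ) ⟨hφ, hτ⟩

/-- At a local minimum, no direction in the linearized feasible cone is a descent direction. -/
theorem exists_nonneg_of_isLocalMinOn {m l : ℕ} {f₀ : X → ℝ} {f : Fin m → X → ℝ}
    {g : Fin l → X → ℝ} {xbar : X}
    (hfeas : xbar ∈ feasibleSet f g) (hopt : IsLocalMinOn f₀ (feasibleSet f g) xbar)
    {A₀ B₀ : Set (WeakDual ℝ X)} {A B : Fin m → Set (WeakDual ℝ X)}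
    {P Q : Fin l → Set (WeakDual ℝ X)}
    (hf₀ : IsQuasidifferentialAt f₀ xbar A₀ B₀) (hf₀H : HadamardDirDiffAt f₀ xbar)
    (hfcont : ∀ i, ∃ U ∈ 𝓝 xbar, ContinuousOn (f i) U)
    (hf : ∀ i, IsQuasidifferentialAt (f i) xbar (A i) (B i))
    (hfU : ∀ i, DirDiffUnifFinDimAt (f i) xbar)
    (hg : ∀ j, IsQuasidifferentialAt (g j) xbar (P j) (Q j))
    (hgusc : ∀ j, g j xbar ≠ 0 → UpperSemicontinuousAt (g j) xbar)
    (hgU : ∀ j, g j xbar = 0 → DirDiffUnifFinDimAt (g j) xbar)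
    {x y : Fin m → WeakDual ℝ X} {z : Fin l → WeakDual ℝ X}
    (hx : ∀ i, x i ∈ A i) (hy : ∀ i, y i ∈ B i) (hz : ∀ j, z j ∈ Q j)
    (hCQ : ConstraintQualification A B x y P z {j | g j xbar = 0})
    {y₀ : WeakDual ℝ X} (hy₀ : y₀ ∈ B₀) {u : X}
    (hA : ∀ i, ∀ φ ∈ A i + {y i}, φ u ≤ 0) (hB : ∀ i, ∀ φ ∈ {-x i} - B i, φ u ≤ 0)
    (hP : ∀ j, g j xbar = 0 → ∀ φ ∈ P j + {z j}, φ u < 0) :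
    ∃ φ ∈ A₀ + {y₀}, 0 ≤ φ u := by
  by_contra! h0
  have hcA : ∀ i, IsCompact (A i + {y i}) := fun i => (hf i).compact_sub.add isCompact_singleton
  have hcB : ∀ i, IsCompact ({-x i} - B i) := fun i => by
    rw [sub_eq_add_neg]
    exact isCompact_singleton.add (hf i).compact_sup.neg
  choose v hv hv' using hCQ.lower
  choose w hw hw' using hCQ.upper
  have hAi : ∀ i, ∀ φ ∈ A i + {y i}, φ (v i) < 0 ∧ ∀ k, k ≠ i → φ (v k) ≤ 0 ∧ φ (w k) ≤ 0 :=
    fun i φ hφ => ⟨(le_supportFn (hcA i) hφ _).trans_lt (hv i), fun k hk =>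
      ⟨(le_supportFn (hcA i) hφ _).trans (hv' k i hk.symm).1,
        (le_supportFn (hcA i) hφ _).trans (hw' k i hk.symm).2⟩⟩
  have hBi : ∀ i, ∀ φ ∈ {-x i} - B i, φ (w i) < 0 ∧ ∀ k, k ≠ i → φ (v k) ≤ 0 ∧ φ (w k) ≤ 0 :=
    fun i φ hφ => ⟨(le_supportFn (hcB i) hφ _).trans_lt (hw i), fun k hk =>
      ⟨(le_supportFn (hcB i) hφ _).trans (hv' k i hk.symm).2,
        (le_supportFn (hcB i) hφ _).trans (hw' k i hk.symm).1⟩⟩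
  -- The constant `ε` is fixed before the step size `α`: Hadamard differentiability makes all
  -- directions in a neighbourhood of `u` descent directions for small `α`, and `ε` keeps the
  -- perturbed directions inside it for every `τ` in the cube.
  obtain ⟨_, _, -, -, hd₀⟩ := hf₀.dirDeriv u
  obtain ⟨pa, hpa, pb, hpb, hdesc⟩ := eventually_prod_iff.1
    (hf₀H.eventually_lt hd₀ (hf₀.hasDirDerivAt_neg hy₀ h0 hd₀))
  have hε₁ : ∀ᶠ ε in 𝓝[>] (0 : ℝ), ∀ τ ∈ unitCube (Fin m), pb (u + ε • cornerMap v w τ) :=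
    mem_nhdsWithin_of_mem_nhds
      (eventually_forall_mem_of_mem_nhds isCompact_unitCube (continuous_cornerMap v w) hpb)
  have hε₂ : ∀ᶠ ε in 𝓝[>] (0 : ℝ), ∀ j, g j xbar = 0 → ∀ τ ∈ unitCube (Fin m),
      ∀ φ ∈ P j + {z j}, φ (u + ε • cornerMap v w τ) < 0 :=
    eventually_all.2 fun j => by
      by_cases hj : g j xbar = 0
      · filter_upwards [mem_nhdsWithin_of_mem_nhds (eventually_forall_apply_neg (v := v) (w := w)
          ((hg j).compact_sub.add isCompact_singleton) (hP j hj))] with ε hε _ using hε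
      · exact Eventually.of_forall fun _ h => absurd h hj
  obtain ⟨ε, hε, hε₁, hε₂⟩ := ((eventually_mem_nhdsWithin (s := Ioi (0 : ℝ)) (a := 0)).and
    (hε₁.and hε₂)).exists
  have hε : 0 < ε := hε
  set U : (Fin m → ℝ) → X := fun τ => u + ε • cornerMap v w τ with hUdef
  have hUc : Continuous U := continuous_const.add ((continuous_cornerMap v w).const_smul ε)
  set X₀ : Submodule ℝ X := Submodule.span ℝ (range v ∪ range w)
  have hfin : FiniteDimensional ℝ X₀ :=
    FiniteDimensional.span_of_finite ℝ ((finite_range v).union (finite_range w))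
  have hUX : ∀ τ, U τ - u ∈ X₀ := fun τ => by
    rw [hUdef, add_sub_cancel_left]
    exact X₀.smul_mem ε (cornerMap_mem_span τ)
  have hface : ∀ (i : Fin m) (c : ℝ), IsCompact (unitCube (Fin m) ∩ {τ | τ i = c}) := fun i c =>
    isCompact_unitCube.inter_right (isClosed_eq (continuous_apply i) continuous_const)
  have hlt : ∀ φ : WeakDual ℝ X, φ u ≤ 0 → ∀ τ, φ (cornerMap v w τ) < 0 → φ (U τ) < 0 := by
    intro φ hφ τ hτ
    simp only [hUdef, map_add, map_smul, smul_eq_mul]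
    linarith [mul_neg_of_pos_of_neg hε hτ]
  have hα₁ : ∀ᶠ α in 𝓝[>] (0 : ℝ), ∀ i, ∀ τ ∈ unitCube (Fin m) ∩ {τ | τ i = 1},
      f i (xbar + α • U τ) < f i xbar :=
    eventually_all.2 fun i => (hfU i).eventually_forall_lt (hface i 1) hUc hfin hUX
      fun τ hτ d hd => (hf i).hasDirDerivAt_neg (hy i) (fun φ hφ => hlt φ (hA i φ hφ) τ
        (apply_cornerMap_neg_of_eq_one hτ.2 (hAi i φ hφ).1 (fun k hk => ((hAi i φ hφ).2 k hk).1)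
          fun k hk => ((hAi i φ hφ).2 k hk).2)) hd
  have hα₂ : ∀ᶠ α in 𝓝[>] (0 : ℝ), ∀ i, ∀ τ ∈ unitCube (Fin m) ∩ {τ | τ i = -1},
      -f i (xbar + α • U τ) < -f i xbar :=
    eventually_all.2 fun i => (hfU i).neg.eventually_forall_lt (hface i (-1)) hUc hfin hUX
      fun τ hτ d hd => neg_pos.1 ((hf i).hasDirDerivAt_pos (hx i) (fun φ hφ => hlt φ (hB i φ hφ) τ
        (apply_cornerMap_neg_of_eq_neg_one hτ.2 (hBi i φ hφ).1
          (fun k hk => ((hBi i φ hφ).2 k hk).1)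
          fun k hk => ((hBi i φ hφ).2 k hk).2)) (by simpa using hd.neg))
  have hnear : ∀ {N : Set X}, N ∈ 𝓝 xbar →
      ∀ᶠ α in 𝓝[>] (0 : ℝ), ∀ τ ∈ unitCube (Fin m), xbar + α • U τ ∈ N := fun hN =>
    mem_nhdsWithin_of_mem_nhds (eventually_forall_mem_of_mem_nhds isCompact_unitCube hUc hN)
  have hα₃ : ∀ᶠ α in 𝓝[>] (0 : ℝ), ∀ j, ∀ τ ∈ unitCube (Fin m), g j (xbar + α • U τ) < 0 := by
    refine eventually_all.2 fun j => ?_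
    by_cases hj : g j xbar = 0
    · have := (hgU j hj).eventually_forall_lt isCompact_unitCube hUc hfin hUX
        fun τ hτ d hd => (hg j).hasDirDerivAt_neg (hz j) (hε₂ j hj τ hτ) hd
      rwa [hj] at this
    · exact hnear (hgusc j hj 0 (lt_of_le_of_ne (hfeas.2 j) hj))
  choose V hV hfV using hfcont
  obtain ⟨α, hpα, hα₁, hα₂, hα₃, hα₄, hα₅⟩ := (hpa.and (hα₁.and (hα₂.and (hα₃.and
    ((eventually_all.2 fun i => hnear (hV i)).and
      (hnear (eventually_nhdsWithin_iff.1 hopt))))))).exists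
  -- The minus sign matches the orientation of the faces: `f i` is negative where `τ i = 1` and
  -- positive where `τ i = -1`.
  obtain ⟨τ, hτ, hzero⟩ := exists_eq_zero_of_signs_on_faces
    (F := fun τ i => -f i (xbar + α • U τ))
    (continuousOn_pi.2 fun i => ((hfV i).comp
      (continuous_const.add (hUc.const_smul α)).continuousOn (hα₄ i)).neg)
    (fun τ hτ i hi => by have := hα₁ i τ ⟨hτ, hi⟩; rw [hfeas.1 i] at this; simpa using this)
    (fun τ hτ i hi => by have := hα₂ i τ ⟨hτ, hi⟩; rw [hfeas.1 i] at this; simpa using this)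
  have hmem : xbar + α • U τ ∈ feasibleSet f g :=
    ⟨fun i => neg_eq_zero.1 (congrFun hzero i), fun j => (hα₃ j τ hτ).le⟩
  exact absurd (hdesc hpα (hε₁ τ hτ)) (not_lt.2 (hα₅ τ hτ hmem))

end Descent

/-! ### Conic and convex combinations of a finite family of sets. -/

section ConvexCombinations

variable {E κ : Type*} [AddCommGroup E] [Module ℝ E] [Fintype κ]

/-- Convexity merges several generators from the same set into one, through `(a + b) • S = a • S + b
• S` for `a, b ≥ 0`. Nonemptiness ensures `0 • S = {0}`, so unused sets do no harm. -/
theorem exists_mem_sum_smul_of_mem_hull {S : κ → Set E} (hS : ∀ k, Convex ℝ (S k))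
    (hne : ∀ k, (S k).Nonempty) {ν : E} (hν : ν ∈ PointedCone.hull ℝ (⋃ k, S k)) :
    ∃ c : κ → ℝ, (∀ k, 0 ≤ c k) ∧ ν ∈ ∑ k, c k • S k := by
  classical
  induction hν using Submodule.span_induction with
  | mem φ hφ =>
    obtain ⟨i, hi⟩ := mem_iUnion.1 hφ
    choose s hs using hne
    refine ⟨Pi.single i 1, fun k => ?_, ?_⟩
    · by_cases hk : k = i
      · subst hk; simp
      · simp [hk]
    · refine mem_fintype_sum _ _ |>.2 ⟨fun k => (Pi.single i 1 : κ → ℝ) k • Function.update s i φ k,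
        fun k => smul_mem_smul_set ?_, ?_⟩
      · by_cases hk : k = i
        · subst hk; simpa using hi
        · simpa [hk] using hs k
      · rw [Finset.sum_eq_single i] <;> simp +contextual
  | zero =>
    refine ⟨0, fun _ => le_rfl, ?_⟩
    simp [zero_smul_set (hne _)]
  | add a b _ _ ha hb =>
    obtain ⟨c, hc, ha⟩ := ha
    obtain ⟨c', hc', hb⟩ := hb
    refine ⟨c + c', fun k => add_nonneg (hc k) (hc' k), ?_⟩
    have := add_mem_add ha hb
    rw [← Finset.sum_add_distrib] at this
    rwa [Finset.sum_congr rfl fun k _ => (hS k).add_smul (hc k) (hc' k) |>.symm] at this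
  | smul r a _ ha =>
    obtain ⟨c, hc, ha⟩ := ha
    refine ⟨fun k => r * c k, fun k => mul_nonneg r.2 (hc k), ?_⟩
    have := smul_mem_smul_set (a := (r : ℝ)) ha
    rw [Finset.smul_sum] at this
    simp_rw [mul_smul]
    exact this

/-- The set of convex combinations with one point from each set of a finite family. -/
def convexCombinations (S : κ → Set E) : Set E := ⋃ w ∈ stdSimplex ℝ κ, ∑ k, w k • S k

theorem convex_convexCombinations {S : κ → Set E} (hS : ∀ k, Convex ℝ (S k)) :
    Convex ℝ (convexCombinations S) := by
  intro φ hφ ψ hψ a b ha hb hab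
  obtain ⟨w, hw, hφ⟩ := mem_iUnion₂.1 hφ
  obtain ⟨w', hw', hψ⟩ := mem_iUnion₂.1 hψ
  refine mem_iUnion₂.2 ⟨a • w + b • w', convex_stdSimplex ℝ κ hw hw' ha hb hab, ?_⟩
  have := add_mem_add (smul_mem_smul_set (a := a) hφ) (smul_mem_smul_set (a := b) hψ)
  rw [Finset.smul_sum, Finset.smul_sum, ← Finset.sum_add_distrib] at this
  simp_rw [← mul_smul] at this
  rwa [Finset.sum_congr rfl fun k _ => (hS k).add_smul (mul_nonneg ha (hw.1 k))
    (mul_nonneg hb (hw'.1 k)) |>.symm] at this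

theorem subset_convexCombinations {S : κ → Set E} (hne : ∀ k, (S k).Nonempty) (i : κ) :
    S i ⊆ convexCombinations S := by
  classical
  intro φ hφ
  choose s hs using hne
  refine mem_iUnion₂.2 ⟨Pi.single i 1, single_mem_stdSimplex ℝ i, mem_fintype_sum _ _ |>.2
    ⟨fun k => (Pi.single i 1 : κ → ℝ) k • Function.update s i φ k,
      fun k => smul_mem_smul_set ?_, ?_⟩⟩
  · by_cases hk : k = i
    · subst hk; simpa using hφ
    · simpa [hk] using hs k
  · rw [Finset.sum_eq_single i] <;> simp +contextual

theorem isCompact_convexCombinations [TopologicalSpace E] [ContinuousAdd E] [ContinuousSMul ℝ E]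
    {S : κ → Set E} (hS : ∀ k, IsCompact (S k)) : IsCompact (convexCombinations S) := by
  have h : convexCombinations S = (fun p : (κ → ℝ) × (κ → E) => ∑ k, p.1 k • p.2 k) ''
      (stdSimplex ℝ κ ×ˢ univ.pi S) := by
    ext φ
    simp only [convexCombinations, mem_iUnion, exists_prop]
    constructor
    · rintro ⟨w, hw, hφ⟩
      obtain ⟨t, ht, rfl⟩ := (mem_fintype_sum _ _).1 hφ
      choose s hs hst using ht
      exact ⟨(w, s), ⟨hw, fun k _ => hs k⟩, Finset.sum_congr rfl fun k _ => hst k⟩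
    · rintro ⟨⟨w, s⟩, ⟨hw, hs⟩, rfl⟩
      exact ⟨w, hw, (mem_fintype_sum _ _).2
        ⟨_, fun k => smul_mem_smul_set (hs k (mem_univ k)), rfl⟩⟩
  rw [h]
  exact ((isCompact_stdSimplex ℝ κ).prod (isCompact_univ_pi hS)).image (by fun_prop)

end ConvexCombinations

/-! ### Weak* separation and the form of the constraint cone. -/

section Separation

variable {X : Type*} [NormedAddCommGroup X] [NormedSpace ℝ X]

instance : LocallyConvexSpace ℝ (WeakDual ℝ X) :=
  inferInstanceAs (LocallyConvexSpace ℝ (WeakBilin (topDualPairing ℝ X)))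

/-- The weak* continuous functionals are the evaluations. -/
theorem exists_eval_eq (F : WeakDual ℝ X →L[ℝ] ℝ) : ∃ v : X, ∀ φ : WeakDual ℝ X, F φ = φ v := by
  obtain ⟨v, hv⟩ := LinearMap.dualEmbedding_surjective (topDualPairing ℝ X) F
  exact ⟨v, fun φ => (DFunLike.congr_fun hv φ).symm⟩

theorem apply_nonpos_of_mem_hull {S : Set (WeakDual ℝ X)} {v : X} (hS : ∀ φ ∈ S, φ v ≤ 0)
    {ν : WeakDual ℝ X} (hν : ν ∈ PointedCone.hull ℝ S) : ν v ≤ 0 := by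
  induction hν using Submodule.span_induction with
  | mem φ hφ => exact hS φ hφ
  | zero => exact le_rfl
  | add a b _ _ ha hb => exact add_nonpos ha hb
  | smul r a _ ha => exact mul_nonpos_of_nonneg_of_nonpos r.2 ha

/-- A compact convex set that misses the negative of a closed cone is strictly negative at a vector
where the cone is nonpositive. -/
theorem exists_separating_vector {K : Set (WeakDual ℝ X)} (hK : Convex ℝ K) (hKc : IsCompact K)
    {N : PointedCone ℝ (WeakDual ℝ X)} (hN : IsClosed (N : Set (WeakDual ℝ X)))
    (hdisj : ∀ φ ∈ K, -φ ∉ N) :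
    ∃ v : X, (∀ φ ∈ K, φ v < 0) ∧ ∀ ν ∈ N, ν v ≤ 0 := by
  obtain ⟨F, a, b, ha, hab, hb⟩ := geometric_hahn_banach_compact_closed hK hKc N.convex.neg hN.neg
    (disjoint_left.2 fun φ hφ h => hdisj φ hφ h)
  obtain ⟨v, hv⟩ := exists_eval_eq F
  simp only [hv] at ha hb
  have hb0 : b < 0 := by
    have := hb 0 (by simp)
    exact this
  refine ⟨v, fun φ hφ => (ha φ hφ).trans (hab.trans hb0), fun ν hν => ?_⟩
  by_contra! hpos
  -- This multiple is scaled so that its negative takes exactly the value `b` at `v`, against the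
  -- strict bound `hb`.
  have hmem : (-b / ν v) • ν ∈ N := N.smul_mem (div_nonneg (by linarith) hpos.le) hν
  have h1 := hb (-((-b / ν v) • ν)) (by simpa using hmem)
  have h2 : (-((-b / ν v) • ν)) v = -((-b / ν v) * ν v) := rfl
  rw [h2, div_mul_cancel₀ _ hpos.ne'] at h1
  linarith

end Separation

theorem exists_mem_sum_smul_of_mem_constraintCone {X : Type*} [NormedAddCommGroup X]
    [NormedSpace ℝ X] {m : ℕ} {A B : Fin m → Set (WeakDual ℝ X)} {x y : Fin m → WeakDual ℝ X}
    (hA : ∀ i, Convex ℝ (A i)) (hB : ∀ i, Convex ℝ (B i)) (hAne : ∀ i, (A i).Nonempty)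
    (hBne : ∀ i, (B i).Nonempty) {ν : WeakDual ℝ X} (hν : ν ∈ constraintCone A B x y) :
    ∃ μl μu : Fin m → ℝ, (∀ i, 0 ≤ μl i) ∧ (∀ i, 0 ≤ μu i) ∧
      ν ∈ ∑ i, μl i • (A i + {y i}) - ∑ i, μu i • ({x i} + B i) := by
  rw [constraintCone_eq, SetLike.mem_coe] at hν
  obtain ⟨c, hc, hν⟩ := exists_mem_sum_smul_of_mem_hull
    (by rintro (i | i)
        · exact (hA i).add (convex_singleton _)
        · exact (convex_singleton _).sub (hB i))
    (by rintro (i | i)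
        · exact (hAne i).add (singleton_nonempty _)
        · exact (singleton_nonempty _).sub (hBne i)) hν
  rw [Fintype.sum_sum_type] at hν
  obtain ⟨p, hp, q, hq, rfl⟩ := hν
  refine ⟨fun i => c (Sum.inl i), fun i => c (Sum.inr i), fun i => hc _, fun i => hc _,
    ⟨p, hp, -q, ?_, sub_neg_eq_add p q⟩⟩
  obtain ⟨t, ht, rfl⟩ := (mem_fintype_sum _ _).1 hq
  refine (mem_fintype_sum _ _).2 ⟨fun i => -t i, fun i => ?_, Finset.sum_neg_distrib _⟩
  obtain ⟨_, ⟨a, rfl, b, hb, rfl⟩, hab⟩ := ht i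
  refine ⟨x i + b, add_mem_add rfl hb, ?_⟩
  simp only at hab ⊢
  rw [← hab, ← smul_neg]
  congr 1
  abel

end Quasidiff

/-! ### The multiplier rule. -/

theorem mainTheorem4 {X : Type*} [NormedAddCommGroup X] [NormedSpace ℝ X] [CompleteSpace X]
    {m l : ℕ} (f₀ : X → ℝ) (f : Fin m → X → ℝ) (g : Fin l → X → ℝ) (xbar : X)
    -- `xbar` is a locally optimal solution
    (hfeas : xbar ∈ Quasidiff.feasibleSet f g)
    (hopt : IsLocalMinOn f₀ (Quasidiff.feasibleSet f g) xbar)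
    -- the given quasidifferentials `[A₀, B₀]` of `f₀`, `[A i, B i]` of `f i`, `[P j, Q j]` of `g j`
    (A₀ B₀ : Set (WeakDual ℝ X)) (A B : Fin m → Set (WeakDual ℝ X))
    (P Q : Fin l → Set (WeakDual ℝ X))
    (hf₀ : Quasidiff.IsQuasidifferentialAt f₀ xbar A₀ B₀)
    (hf₀H : Quasidiff.HadamardDirDiffAt f₀ xbar)
    (hfcont : ∀ i, ∃ U ∈ 𝓝 xbar, ContinuousOn (f i) U)
    (hf : ∀ i, Quasidiff.IsQuasidifferentialAt (f i) xbar (A i) (B i))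
    (hfU : ∀ i, Quasidiff.DirDiffUnifFinDimAt (f i) xbar)
    (hg : ∀ j, Quasidiff.IsQuasidifferentialAt (g j) xbar (P j) (Q j))
    (hgusc : ∀ j, g j xbar ≠ 0 → UpperSemicontinuousAt (g j) xbar)
    (hgU : ∀ j, g j xbar = 0 → Quasidiff.DirDiffUnifFinDimAt (g j) xbar)
    -- selected elements; the `z j` with `g j xbar ≠ 0` are arbitrary elements of `Q j`
    (x y : Fin m → WeakDual ℝ X) (z : Fin l → WeakDual ℝ X)
    (hx : ∀ i, x i ∈ A i) (hy : ∀ i, y i ∈ B i) (hz : ∀ j, z j ∈ Q j)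
    (hCQ : Quasidiff.ConstraintQualification A B x y P z {j | g j xbar = 0}) :
    (IsClosed (Quasidiff.constraintCone A B x y) →
      ∀ y₀ ∈ B₀, ∃ (μl μu : Fin m → ℝ) (lam : Fin l → ℝ),
        (∀ i, 0 ≤ μl i) ∧ (∀ i, 0 ≤ μu i) ∧ (∀ j, 0 ≤ lam j) ∧
        (∀ j, lam j * g j xbar = 0) ∧
        (0 : WeakDual ℝ X) ∈
          A₀ + {y₀} + ∑ i, μl i • (A i + {y i}) - ∑ i, μu i • ({x i} + B i)
            + ∑ j, lam j • (P j + {z j})) ∧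
    ((∀ i, Quasidiff.IsPolytope (A i) ∧ Quasidiff.IsPolytope (B i)) →
      IsClosed (Quasidiff.constraintCone A B x y)) := by
  refine ⟨fun hcl y₀ hy₀ => ?_, Quasidiff.isClosed_constraintCone_of_isPolytope x y⟩
  -- The index `none` stands for the objective, `some j` for an active inequality.
  set S : Option {j : Fin l // g j xbar = 0} → Set (WeakDual ℝ X) :=
    fun k => k.elim (A₀ + {y₀}) (fun j => P j + {z j}) with hS
  have hSconv : ∀ k, Convex ℝ (S k) := by
    rintro (_ | j)
    · exact hf₀.convex_sub.add (convex_singleton _)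
    · exact (hg j).convex_sub.add (convex_singleton _)
  have hScomp : ∀ k, IsCompact (S k) := by
    rintro (_ | j)
    · exact hf₀.compact_sub.add isCompact_singleton
    · exact (hg j).compact_sub.add isCompact_singleton
  have hSne : ∀ k, (S k).Nonempty := by
    rintro (_ | j)
    · exact hf₀.nonempty_sub.add (singleton_nonempty _)
    · exact (hg j).nonempty_sub.add (singleton_nonempty _)
  obtain ⟨φ, hφ, hφN⟩ : ∃ φ ∈ Quasidiff.convexCombinations S,
      -φ ∈ Quasidiff.constraintCone A B x y := by
    by_contra! hdisj
    obtain ⟨v, hv, hvN⟩ := Quasidiff.exists_separating_vector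
      (Quasidiff.convex_convexCombinations hSconv)
      (Quasidiff.isCompact_convexCombinations hScomp) hcl hdisj
    obtain ⟨φ, hφ, hφv⟩ := Quasidiff.exists_nonneg_of_isLocalMinOn hfeas hopt hf₀ hf₀H hfcont hf
      hfU hg hgusc hgU hx hy hz hCQ hy₀ (u := v)
      (fun i φ hφ => hvN φ (PointedCone.subset_hull (mem_iUnion.2 ⟨i, Or.inl hφ⟩)))
      (fun i φ hφ => hvN φ (PointedCone.subset_hull (mem_iUnion.2 ⟨i, Or.inr hφ⟩)))
      (fun j hj φ hφ => hv φ (Quasidiff.subset_convexCombinations hSne (some ⟨j, hj⟩) hφ))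
    exact absurd (hv φ (Quasidiff.subset_convexCombinations hSne none hφ)) (not_lt.2 hφv)
  obtain ⟨w, hw, hφ⟩ := mem_iUnion₂.1 hφ
  obtain ⟨t, ht, hφt⟩ := (mem_fintype_sum _ _).1 hφ
  choose s hs hst using ht
  have hφs : φ = w none • s none + ∑ j, w (some j) • s (some j) := by
    rw [← hφt, Fintype.sum_option, ← hst none]
    simp only [← hst]
  -- Were this weight zero, `φ` would be a convex combination of active constraint functionals
  -- alone, hence negative at the Slater vector, while `-φ` in the constraint cone makes it
  -- nonnegative there.
  have hw0 : 0 < w none := by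
    refine lt_of_le_of_ne (hw.1 none) fun h0 => ?_
    obtain ⟨v, hvP, hvAB⟩ := hCQ.slater
    have hνv : (-φ) v ≤ 0 := by
      refine Quasidiff.apply_nonpos_of_mem_hull (fun ψ hψ => ?_) hφN
      obtain ⟨i, hψ | hψ⟩ := mem_iUnion.1 hψ
      · exact (Quasidiff.le_supportFn ((hf i).compact_sub.add isCompact_singleton) hψ v).trans
          (hvAB i).1
      · refine (Quasidiff.le_supportFn ?_ hψ v).trans (hvAB i).2
        rw [sub_eq_add_neg]
        exact isCompact_singleton.add (hf i).compact_sup.neg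
    have hsv : ∀ j : {j // g j xbar = 0}, s (some j) v < 0 := fun j =>
      (Quasidiff.le_supportFn ((hg j).compact_sub.add isCompact_singleton) (hs (some j)) v).trans_lt
        (hvP j j.2)
    have hsum : ∑ j, w (some j) = 1 := by
      have := hw.2
      rwa [Fintype.sum_option, ← h0, zero_add] at this
    obtain ⟨j, -, hj⟩ := Finset.exists_ne_zero_of_sum_ne_zero (hsum.trans_ne one_ne_zero)
    have hφv : φ v = ∑ j, w (some j) * s (some j) v := by
      rw [hφs, ← h0, zero_smul, zero_add]
      exact map_sum ((topDualPairing ℝ X).flip v) _ _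
    have hneg : φ v < 0 := by
      rw [hφv]
      refine (Finset.sum_lt_sum (g := fun _ => 0) (fun k _ => ?_)
        ⟨j, Finset.mem_univ j, ?_⟩).trans_eq Finset.sum_const_zero
      · exact mul_nonpos_of_nonneg_of_nonpos (hw.1 _) (hsv k).le
      · exact mul_neg_of_pos_of_neg (lt_of_le_of_ne (hw.1 _) hj.symm) (hsv j)
    have : -(φ v) ≤ 0 := hνv
    linarith
  obtain ⟨μl, μu, hμl, hμu, hν⟩ := Quasidiff.exists_mem_sum_smul_of_mem_constraintCone
    (fun i => (hf i).convex_sub) (fun i => (hf i).convex_sup) (fun i => (hf i).nonempty_sub)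
    (fun i => (hf i).nonempty_sup)
    (PointedCone.smul_mem _ (inv_nonneg.2 hw0.le) hφN)
  classical
  -- Arbitrary points for the inactive constraints, which enter with multiplier zero.
  choose e he using fun j => (hg j).nonempty_sub.add (singleton_nonempty (z j))
  set lam : Fin l → ℝ := fun j => if h : g j xbar = 0 then (w none)⁻¹ * w (some ⟨j, h⟩) else 0
    with hlam
  set r : Fin l → WeakDual ℝ X := fun j => if h : g j xbar = 0 then s (some ⟨j, h⟩) else e j
    with hr
  have hrmem : ∀ j, r j ∈ P j + {z j} := fun j => by
    by_cases h : g j xbar = 0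
    · rw [show r j = s (some ⟨j, h⟩) from dif_pos h]
      exact hs (some ⟨j, h⟩)
    · rw [show r j = e j from dif_neg h]
      exact he j
  have hrsum : ∑ j, lam j • r j = (w none)⁻¹ • ∑ j, w (some j) • s (some j) := by
    rw [← Fintype.sum_subtype_add_sum_subtype (fun j => g j xbar = 0) fun j => lam j • r j,
      Finset.sum_eq_zero (s := (Finset.univ : Finset {j // ¬ g j xbar = 0})) fun j _ => by
        simp [hlam, j.2], add_zero, Finset.smul_sum]
    refine Finset.sum_congr rfl fun j _ => ?_
    simp only [hlam, hr, j.2, dif_pos, mul_smul, Subtype.coe_eta]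
  refine ⟨μl, μu, lam, hμl, hμu, fun j => ?_, fun j => ?_, ?_⟩
  · by_cases h : g j xbar = 0
    · simp only [hlam, h, dif_pos]
      exact mul_nonneg (inv_nonneg.2 hw0.le) (hw.1 _)
    · simp [hlam, h]
  · by_cases h : g j xbar = 0
    · simp [h]
    · simp [hlam, h]
  · rw [add_sub_assoc]
    have hmem := add_mem_add (add_mem_add (hs none) hν)
      ((mem_fintype_sum _ _).2 ⟨_, fun j => smul_mem_smul_set (a := lam j) (hrmem j), rfl⟩)
    suffices h : s none + (w none)⁻¹ • -φ + ∑ j, lam j • r j = 0 from h ▸ hmem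
    rw [hrsum, hφs, smul_neg, smul_add, smul_smul, inv_mul_cancel₀ hw0.ne', one_smul]
    abel
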